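/- **Setting.** For a graph $H$ and $n\ge 1$ let $$\mathsf{ColSub}_{H,n}=\sum_{f:V(H)\to[n]}\ \prod_{uv\in E(H)}x^{(uv)}_{f(u),f(v)},$$ where $x^{(uv)}_{i,j}$ and $x^{(vu)}_{j,i}$ denote the same variable. An algebraic circuit over $\mathbb Q$ is a finite directed acyclic graph with a designated output gate; its leaves (input gates) are labelled by variables or constants, and its inner gates, of unbounded fan-in, compute the sum or the product of their children. It is monotone if all its constants are non-negative. Its size is its number of gates (input gates included), and its product-depth is the maximum number of product gates on a directed path starting at the output gate. It is layered if the output gate is its only root, every edge goes from one layer to the next, and sum and product gates alternate along every path; the product-depth is then the number of multiplication layers. **Theorem.** There are absolute constants $K,c>0$ such that the following holds. 1. For all integers $\Delta\ge 1$ and $k\ge 2$ there is a pattern graph $H=H_{\Delta}$, a tree with $|H|=k$ vertices, such that for every $n\ge 1$: * $\mathsf{ColSub}_{H,n}$ is computed by a layered monotone circuit of product-depth at most $\Delta+1$ and size at most $K\,n^{2}|H|$; * every monotone circuit (layered or not) of product-depth at most $\Delta$ that computes $\mathsf{ColSub}_{H,n}$ has size at least $n^{c|H|^{1/\Delta}}$.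 2. In particular, for all integers $\Delta\ge 1$ and $n\ge 1$ there is a pattern graph $H=H_\Delta$, a tree with exactly $n$ vertices, such that $\mathsf{ColSub}_{H,n}$ is computed by a layered monotone circuit of product-depth at most $\Delta+1$ and size at most $K n^{3}$, whereas every monotone circuit (layered or not) of product-depth at most $\Delta$ that computes it has size at least $n^{c\,n^{1/\Delta}}$. -/

import Mathlib

/-- The label of a gate of an algebraic circuit over `ℚ` with variables `σ` and set of gates `V`:
an input gate holds a variable or a constant, an inner gate is a sum or a product of its
children. -/
inductive GateLabel (σ V : Type) : Type where
  | var (x : σ)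
  | const (a : ℚ)
  | add (children : Finset V)
  | mul (children : Finset V)

namespace GateLabel

variable {σ V : Type}

/-- The children of a gate; input gates have none. -/
def children : GateLabel σ V → Finset V
  | var _ => ∅
  | const _ => ∅
  | add s => s
  | mul s => s

/-- The gate is a sum gate. -/
def IsAdd : GateLabel σ V → Prop
  | add _ => True
  | _ => False

/-- The gate is a product gate. -/
def IsMul : GateLabel σ V → Prop
  | mul _ => True
  | _ => False

end GateLabel

/-- An algebraic circuit over `ℚ` with variables `σ`: a finite directed acyclic graph of labelled
gates, of unbounded fan-in and fan-out, with a designated output gate. -/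
structure AlgCircuit (σ : Type) where
  /-- The gates, that is, the vertices of the underlying graph. -/
  V : Type
  [fintypeV : Fintype V]
  /-- The label of each gate; it also determines the children of the gate. -/
  gate : V → GateLabel σ V
  /-- The output gate. -/
  output : V
  /-- There is no directed cycle (for a finite graph this is well-foundedness). -/
  acyclic : WellFounded fun h g : V => h ∈ (gate g).children
  /-- Only input gates are leaves. -/
  nonempty_of_inner : ∀ g, (gate g).IsAdd ∨ (gate g).IsMul → (gate g).children.Nonempty

namespace AlgCircuit

variable {σ : Type}

attribute [instance] AlgCircuit.fintypeV

/-- The size of a circuit: its number of gates, input gates included. -/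
def size (C : AlgCircuit σ) : ℕ := Fintype.card C.V

/-- The polynomial computed by a gate with a given label, from those computed by its children. -/
noncomputable def evalLabel {V : Type} :
    (l : GateLabel σ V) → ((h : V) → h ∈ l.children → MvPolynomial σ ℚ) → MvPolynomial σ ℚ
  | .var x, _ => MvPolynomial.X x
  | .const a, _ => MvPolynomial.C a
  | .add s, p => ∑ h ∈ s.attach, p h.1 h.2
  | .mul s, p => ∏ h ∈ s.attach, p h.1 h.2

/-- The polynomial computed at a gate. -/
noncomputable def gatePoly (C : AlgCircuit σ) : C.V → MvPolynomial σ ℚ :=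
  C.acyclic.fix fun g p => evalLabel (C.gate g) p

/-- The polynomial computed by the circuit. -/
noncomputable def poly (C : AlgCircuit σ) : MvPolynomial σ ℚ := C.gatePoly C.output

/-- The product-depth of a gate with a given label, from those of its children. -/
def depthLabel {V : Type} :
    (l : GateLabel σ V) → ((h : V) → h ∈ l.children → ℕ) → ℕ
  | .var _, _ => 0
  | .const _, _ => 0
  | .add s, p => s.attach.sup fun h => p h.1 h.2
  | .mul s, p => (s.attach.sup fun h => p h.1 h.2) + 1

/-- The maximum number of product gates on a directed path that starts at the given gate. -/
noncomputable def gateDepth (C : AlgCircuit σ) : C.V → ℕ :=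
  C.acyclic.fix fun g p => depthLabel (C.gate g) p

/-- The product-depth: the maximum number of product gates on a directed path from the output
gate. In a layered circuit this is the number of multiplication layers. -/
noncomputable def productDepth (C : AlgCircuit σ) : ℕ := C.gateDepth C.output

/-- A circuit is monotone if all its constants are non-negative. -/
def IsMonotone (C : AlgCircuit σ) : Prop :=
  ∀ (g : C.V) (a : ℚ), C.gate g = .const a → 0 ≤ a

/-- The circuit is layered with the output gate as its unique root, every edge going from one layer
to the next, and sum gates and product gates alternate along every path. -/
structure IsLayered (C : AlgCircuit σ) : Prop where
  layers : ∃ layer : C.V → ℕ, layer C.output = 0 ∧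
    ∀ g, ∀ h ∈ (C.gate g).children, layer h = layer g + 1
  unique_root : ∀ g, g ≠ C.output → ∃ p, g ∈ (C.gate p).children
  add_alternate : ∀ g, (C.gate g).IsAdd → ∀ h ∈ (C.gate g).children, ¬ (C.gate h).IsAdd
  mul_alternate : ∀ g, (C.gate g).IsMul → ∀ h ∈ (C.gate g).children, ¬ (C.gate h).IsMul

theorem gatePoly_eq (C : AlgCircuit σ) (g : C.V) :
    C.gatePoly g = evalLabel (C.gate g) fun h _ => C.gatePoly h :=
  C.acyclic.fix_eq _ g

theorem gateDepth_eq (C : AlgCircuit σ) (g : C.V) :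
    C.gateDepth g = depthLabel (C.gate g) fun h _ => C.gateDepth h :=
  C.acyclic.fix_eq _ g

end AlgCircuit

open Classical in
/-- The colored subgraph polynomial `∑ f : V(H) → [n], ∏ uv ∈ E(H), x^{(uv)}_{f(u), f(v)}` of a
pattern graph `H`. The variable `x^{(uv)}_{i,j}` is indexed by the edge `{(u, i), (v, j)}` of the
blow-up of `H`, so that `x^{(uv)}_{i,j}` and `x^{(vu)}_{j,i}` are the same variable. -/
noncomputable def colSub {V : Type} [Fintype V] (H : SimpleGraph V) (n : ℕ) :
    MvPolynomial (Sym2 (V × Fin n)) ℚ :=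
  ∑ f : V → Fin n, ∏ e ∈ H.edgeFinset, MvPolynomial.X (e.map fun u => (u, f u))

open MvPolynomial

/-! The hard pattern is a `d`-ary tree of depth `Δ` with a pendant vertex at each leaf, where `d` is
about `(k/3)^(1/Δ)`; spare vertices hang from the root.

Lower bound. Without cancellation, each monomial of the output, that is, each coloring `f`, can be
traced down through the circuit, and every product gate met on the way splits the edges it covers
among its children. Call a vertex a boundary vertex of this split if some child covers one of its
edges but not another. With fewer than `d` boundary vertices, one of the `d` subtrees below the
current branching vertex contains none of them. It is then covered by a single child, and the trace
continues there with one level of branching and at least one product gate fewer. Depth `Δ` does not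
suffice to exhaust the tree, so some product gate has at least `d` boundary vertices
(`exists_mul_gate_of_isBranching`). Two colorings traced to the same such gate can exchange factors;
as every monomial of the output is a proper coloring monomial, they agree on the boundary
(`eq_of_mem_boundary`). Hence a gate serves at most `n^(k-d)` of the `n^k` colorings, and there are
at least `n^d` gates (`pow_le_size_of_isBranching`).

Upper bound. Dynamic programming from the leaves to the root, with one layer of products per level
(`treeCircuit`, `sum_prod_children_eq`). -/

/-! ### Supports of sums and products of polynomials with non-negative coefficients. -/

theorem coeff_prod_nonneg {σ ι : Type} (s : Finset ι) (p : ι → MvPolynomial σ ℚ)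
    (hp : ∀ i ∈ s, ∀ m, 0 ≤ (p i).coeff m) (m : σ →₀ ℕ) : 0 ≤ (∏ i ∈ s, p i).coeff m := by
  classical
  induction s using Finset.induction_on generalizing m with
  | empty => rw [Finset.prod_empty, coeff_one]; split_ifs <;> norm_num
  | insert a s ha ih =>
    rw [Finset.prod_insert ha, coeff_mul]
    exact Finset.sum_nonneg fun x _ => mul_nonneg (hp a (Finset.mem_insert_self a s) _)
      (ih (fun i hi => hp i (Finset.mem_insert_of_mem hi)) _)

theorem exists_of_mem_support_sum {σ ι : Type} {s : Finset ι} {p : ι → MvPolynomial σ ℚ}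
    {m : σ →₀ ℕ} (h : m ∈ (∑ i ∈ s, p i).support) : ∃ i ∈ s, m ∈ (p i).support := by
  classical
  simpa using support_sum h

theorem exists_of_mem_support_prod {σ ι : Type} {s : Finset ι} {p : ι → MvPolynomial σ ℚ}
    {m : σ →₀ ℕ} (h : m ∈ (∏ i ∈ s, p i).support) :
    ∃ μ : ι → σ →₀ ℕ, (∀ i ∈ s, μ i ∈ (p i).support) ∧ ∑ i ∈ s, μ i = m := by
  classical
  induction s using Finset.induction_on generalizing m with
  | empty =>
    rw [Finset.prod_empty, mem_support_iff, coeff_one] at h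
    exact ⟨fun _ => 0, by simp, by simpa using h⟩
  | insert a s ha ih =>
    rw [Finset.prod_insert ha] at h
    obtain ⟨x, hx, y, hy, rfl⟩ := Finset.mem_add.1 (support_mul _ _ h)
    obtain ⟨μ, hμ, rfl⟩ := ih hy
    refine ⟨Function.update μ a x, fun i hi => ?_, ?_⟩
    · rcases Finset.mem_insert.1 hi with rfl | hi
      · simpa using hx
      · rw [Function.update_of_ne (ne_of_mem_of_not_mem hi ha)]
        exact hμ i hi
    · rw [Finset.sum_insert ha, Function.update_self]
      congr 1
      exact Finset.sum_congr rfl fun i hi =>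
        Function.update_of_ne (ne_of_mem_of_not_mem hi ha) _ _

/-- Non-negative coefficients cannot cancel. This and its analogue for products are the only places
where monotonicity acts on supports. -/
theorem mem_support_sum_of_nonneg {σ ι : Type} {s : Finset ι} {p : ι → MvPolynomial σ ℚ}
    (hp : ∀ i ∈ s, ∀ m, 0 ≤ (p i).coeff m) {i : ι} (hi : i ∈ s) {m : σ →₀ ℕ}
    (hm : m ∈ (p i).support) : m ∈ (∑ i ∈ s, p i).support := by
  rw [mem_support_iff] at *
  rw [coeff_sum]
  have h1 : 0 < (p i).coeff m := lt_of_le_of_ne (hp i hi m) hm.symm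
  exact (h1.trans_le
    (Finset.single_le_sum (f := fun i => (p i).coeff m) (fun i hi => hp i hi m) hi)).ne'

theorem mem_support_prod_of_nonneg {σ ι : Type} {s : Finset ι} {p : ι → MvPolynomial σ ℚ}
    (hp : ∀ i ∈ s, ∀ m, 0 ≤ (p i).coeff m) {μ : ι → σ →₀ ℕ}
    (hμ : ∀ i ∈ s, μ i ∈ (p i).support) : ∑ i ∈ s, μ i ∈ (∏ i ∈ s, p i).support := by
  classical
  induction s using Finset.induction_on with
  | empty => simp
  | insert a s ha ih =>
    have hs : ∀ i ∈ s, ∀ m, 0 ≤ (p i).coeff m := fun i hi => hp i (Finset.mem_insert_of_mem hi)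
    have h2 := ih hs fun i hi => hμ i (Finset.mem_insert_of_mem hi)
    have h1 := hμ a (Finset.mem_insert_self a s)
    have h0 := hp a (Finset.mem_insert_self a s)
    rw [Finset.prod_insert ha, Finset.sum_insert ha]
    rw [mem_support_iff] at *
    have h3 := coeff_prod_nonneg s p hs
    rw [coeff_mul]
    refine ((mul_pos (lt_of_le_of_ne (h0 _) h1.symm) (lt_of_le_of_ne (h3 _) h2.symm)).trans_le
      (Finset.single_le_sum (f := fun x : (σ →₀ ℕ) × (σ →₀ ℕ) =>
        (p a).coeff x.1 * (∏ i ∈ s, p i).coeff x.2)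
        (fun x _ => mul_nonneg (h0 _) (h3 _)) (a := (μ a, ∑ i ∈ s, μ i)) ?_)).ne'
    simp

/-! ### Gate polynomials, product-depth, and contexts of gates in monotone circuits. -/

namespace AlgCircuit

variable {σ : Type} (C : AlgCircuit σ)

theorem gatePoly_of_var {g : C.V} {x : σ} (h : C.gate g = .var x) : C.gatePoly g = X x := by
  rw [gatePoly_eq, h]; rfl

theorem gatePoly_of_const {g : C.V} {a : ℚ} (h : C.gate g = .const a) :
    C.gatePoly g = MvPolynomial.C a := by
  rw [gatePoly_eq, h]; rfl

theorem gatePoly_of_add {g : C.V} {s : Finset C.V} (h : C.gate g = .add s) :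
    C.gatePoly g = ∑ h ∈ s, C.gatePoly h := by
  rw [gatePoly_eq, h]
  exact Finset.sum_attach s C.gatePoly

theorem gatePoly_of_mul {g : C.V} {s : Finset C.V} (h : C.gate g = .mul s) :
    C.gatePoly g = ∏ h ∈ s, C.gatePoly h := by
  rw [gatePoly_eq, h]
  exact Finset.prod_attach s C.gatePoly

theorem gateDepth_le_of_add {g h : C.V} {s : Finset C.V} (hg : C.gate g = .add s) (hh : h ∈ s) :
    C.gateDepth h ≤ C.gateDepth g := by
  rw [gateDepth_eq C g, hg]
  exact Finset.le_sup (f := fun h : s => C.gateDepth h.1) (Finset.mem_attach s ⟨h, hh⟩)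

theorem gateDepth_lt_of_mul {g h : C.V} {s : Finset C.V} (hg : C.gate g = .mul s) (hh : h ∈ s) :
    C.gateDepth h < C.gateDepth g := by
  rw [gateDepth_eq C g, hg]
  exact Nat.lt_succ_of_le
    (Finset.le_sup (f := fun h : s => C.gateDepth h.1) (Finset.mem_attach s ⟨h, hh⟩))

theorem gateDepth_pos_of_mul {g : C.V} {s : Finset C.V} (hg : C.gate g = .mul s) :
    0 < C.gateDepth g := by
  rw [gateDepth_eq C g, hg]
  exact Nat.succ_pos _

/-- Bounds the depth of a concrete circuit from local inequalities, without evaluating the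
recursion. -/
theorem gateDepth_le_of_potential (φ : C.V → ℕ)
    (hadd : ∀ g s, C.gate g = .add s → ∀ h ∈ s, φ h ≤ φ g)
    (hmul : ∀ g s, C.gate g = .mul s → 0 < φ g ∧ ∀ h ∈ s, φ h < φ g) (g : C.V) :
    C.gateDepth g ≤ φ g := by
  induction g using C.acyclic.induction with
  | _ g ih =>
    rw [gateDepth_eq]
    cases hg : C.gate g with
    | var x => exact Nat.zero_le _
    | const a => exact Nat.zero_le _
    | add s =>
      exact Finset.sup_le fun h _ => (ih h.1 (by rw [hg]; exact h.2)).trans (hadd g s hg h.1 h.2)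
    | mul s =>
      obtain ⟨h0, h1⟩ := hmul g s hg
      refine Nat.succ_le_of_lt ((Finset.sup_lt_iff h0).2 fun h _ => ?_)
      exact (ih h.1 (by rw [hg]; exact h.2)).trans_lt (h1 h.1 h.2)

variable {C}

theorem IsMonotone.coeff_nonneg (hC : C.IsMonotone) (g : C.V) (m : σ →₀ ℕ) :
    0 ≤ (C.gatePoly g).coeff m := by
  classical
  induction g using C.acyclic.induction generalizing m with
  | _ g ih =>
    cases hg : C.gate g with
    | var x => rw [C.gatePoly_of_var hg, coeff_X]; split_ifs <;> norm_num
    | const a =>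
      rw [C.gatePoly_of_const hg, coeff_C]
      split_ifs
      · exact hC g a hg
      · exact le_rfl
    | add s =>
      rw [C.gatePoly_of_add hg, coeff_sum]
      exact Finset.sum_nonneg fun h hh => ih h (by rw [hg]; exact hh) m
    | mul s =>
      rw [C.gatePoly_of_mul hg]
      exact coeff_prod_nonneg _ _ (fun h hh => ih h (by rw [hg]; exact hh)) m

/-- Every variable that occurs in a monomial of a gate labels some gate. -/
theorem exists_var_gate (g : C.V) {m : σ →₀ ℕ} (hm : m ∈ (C.gatePoly g).support) {x : σ}
    (hx : m x ≠ 0) : ∃ h, C.gate h = .var x := by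
  classical
  induction g using C.acyclic.induction generalizing m with
  | _ g ih =>
    cases hg : C.gate g with
    | var y =>
      rw [C.gatePoly_of_var hg, support_X, Finset.mem_singleton] at hm
      subst hm
      obtain rfl : y = x := by
        by_contra hne
        exact hx (Finsupp.single_eq_of_ne' hne)
      exact ⟨g, hg⟩
    | const a =>
      rw [C.gatePoly_of_const hg, mem_support_iff, coeff_C] at hm
      have : 0 = m := by by_contra hne; exact hm (if_neg hne)
      subst this
      exact absurd rfl hx
    | add s =>
      rw [C.gatePoly_of_add hg] at hm
      obtain ⟨h, hh, hm⟩ := exists_of_mem_support_sum hm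
      exact ih h (by rw [hg]; exact hh) hm hx
    | mul s =>
      rw [C.gatePoly_of_mul hg] at hm
      obtain ⟨μ, hμ, rfl⟩ := exists_of_mem_support_prod hm
      rw [Finsupp.finsetSum_apply] at hx
      obtain ⟨h, hh, hx⟩ := Finset.exists_ne_zero_of_sum_ne_zero hx
      exact ih h (by rw [hg]; exact hh) (hμ h hh) hx

/-- Multiplying any monomial of the gate `g` by `m'` gives a monomial of the output. -/
def Completes (C : AlgCircuit σ) (m' : σ →₀ ℕ) (g : C.V) : Prop :=
  ∀ m ∈ (C.gatePoly g).support, m' + m ∈ C.poly.support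

theorem Completes.of_add (hC : C.IsMonotone) {m' : σ →₀ ℕ} {g h : C.V} {s : Finset C.V}
    (hm' : C.Completes m' g) (hg : C.gate g = .add s) (hh : h ∈ s) : C.Completes m' h := by
  intro m hm
  apply hm'
  rw [C.gatePoly_of_add hg]
  exact mem_support_sum_of_nonneg (fun i _ => hC.coeff_nonneg i) hh hm

/-- With the monomials of the siblings frozen, the factor at `h` can be replaced by any other
monomial of `h`. The frozen siblings become part of the context. -/
theorem Completes.of_mul [DecidableEq C.V] (hC : C.IsMonotone) {m' : σ →₀ ℕ} {g h : C.V}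
    {s : Finset C.V} (hm' : C.Completes m' g) (hg : C.gate g = .mul s) (hh : h ∈ s)
    {μ : C.V → σ →₀ ℕ} (hμ : ∀ i ∈ s, μ i ∈ (C.gatePoly i).support) :
    C.Completes (m' + ∑ i ∈ s.erase h, μ i) h := by
  intro m hm
  have := hm' (∑ i ∈ s, Function.update μ h m i) (by
    rw [C.gatePoly_of_mul hg]
    refine mem_support_prod_of_nonneg (fun i _ => hC.coeff_nonneg i) fun i hi => ?_
    by_cases hih : i = h
    · subst hih; simpa using hm
    · rw [Function.update_of_ne hih]; exact hμ i hi)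
  have hsum : ∑ i ∈ s.erase h, Function.update μ h m i = ∑ i ∈ s.erase h, μ i :=
    Finset.sum_congr rfl fun i hi => Function.update_of_ne (Finset.ne_of_mem_erase hi) m μ
  rw [← Finset.add_sum_erase s _ hh, Function.update_self, hsum] at this
  rwa [add_assoc, add_comm (∑ i ∈ s.erase h, μ i) m]

end AlgCircuit

/-! ### Monomials of the colored subgraph polynomial and the exchange argument. -/

section ColSub

variable {V : Type} {n : ℕ}

/-- The edges of the pattern graph underlying a monomial, with multiplicity. -/
noncomputable def patternEdges : (Sym2 (V × Fin n) →₀ ℕ) →+ (Sym2 V →₀ ℕ) :=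
  Finsupp.mapDomain.addMonoidHom (Sym2.map Prod.fst)

/-- A monomial that covers an edge at `u` assigns a color to `u`. -/
theorem exists_color_of_patternEdges_ne_zero {m : Sym2 (V × Fin n) →₀ ℕ} {e : Sym2 V}
    (he : patternEdges m e ≠ 0) {u : V} (hu : u ∈ e) :
    ∃ i, ∃ x, m x ≠ 0 ∧ (u, i) ∈ x := by
  classical
  have : e ∈ (Finsupp.mapDomain (Sym2.map Prod.fst) m).support := Finsupp.mem_support_iff.2 he
  obtain ⟨x, hx, rfl⟩ := Finset.mem_image.1 (Finsupp.mapDomain_support this)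
  obtain ⟨⟨w, i⟩, hw, rfl⟩ := Sym2.mem_map.1 hu
  exact ⟨i, x, Finsupp.mem_support_iff.1 hx, hw⟩

variable [Fintype V]

open Classical in
/-- The monomial of `colSub H n` that belongs to the coloring `f`. -/
noncomputable def colMonomial (H : SimpleGraph V) (f : V → Fin n) : Sym2 (V × Fin n) →₀ ℕ :=
  ∑ e ∈ H.edgeFinset, Finsupp.single (e.map fun u => (u, f u)) 1

open Classical in
theorem colSub_eq_sum_monomial (H : SimpleGraph V) (n : ℕ) :
    colSub H n = ∑ f : V → Fin n, monomial (colMonomial H f) 1 := by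
  unfold colSub colMonomial
  refine Finset.sum_congr rfl fun f _ => ?_
  rw [monomial_sum_one]
  rfl

theorem mem_support_colSub {H : SimpleGraph V} {m : Sym2 (V × Fin n) →₀ ℕ} :
    m ∈ (colSub H n).support ↔ ∃ f : V → Fin n, colMonomial H f = m := by
  classical
  rw [colSub_eq_sum_monomial]
  constructor
  · intro h
    obtain ⟨f, -, hf⟩ := exists_of_mem_support_sum h
    refine ⟨f, ?_⟩
    rw [support_monomial, if_neg one_ne_zero, Finset.mem_singleton] at hf
    exact hf.symm
  · rintro ⟨f, rfl⟩
    refine mem_support_sum_of_nonneg (fun f _ m => ?_) (Finset.mem_univ f) ?_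
    · rw [coeff_monomial]; split_ifs <;> norm_num
    · rw [support_monomial, if_neg one_ne_zero, Finset.mem_singleton]

open Classical in
theorem patternEdges_colMonomial (H : SimpleGraph V) (f : V → Fin n) :
    patternEdges (colMonomial H f) = ∑ e ∈ H.edgeFinset, Finsupp.single e 1 := by
  unfold patternEdges colMonomial
  rw [map_sum]
  refine Finset.sum_congr rfl fun e _ => ?_
  rw [Finsupp.mapDomain.addMonoidHom_apply, Finsupp.mapDomain_single, Sym2.map_map]
  congr 1
  exact congrFun Sym2.map_id e

theorem patternEdges_colMonomial_ne_zero {H : SimpleGraph V} (f : V → Fin n) {e : Sym2 V}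
    (he : e ∈ H.edgeSet) : patternEdges (colMonomial H f) e ≠ 0 := by
  classical
  rw [patternEdges_colMonomial, Finsupp.finsetSum_apply]
  refine (Finset.sum_pos' (fun _ _ => Nat.zero_le _)
    ⟨e, H.mem_edgeFinset.2 he, ?_⟩).ne'
  simp

theorem eq_of_mem_of_colMonomial_ne_zero {H : SimpleGraph V} {f : V → Fin n}
    {x : Sym2 (V × Fin n)} (hx : colMonomial H f x ≠ 0) {u : V} {i : Fin n} (hu : (u, i) ∈ x) :
    f u = i := by
  classical
  unfold colMonomial at hx
  rw [Finsupp.finsetSum_apply] at hx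
  obtain ⟨e, -, he⟩ := Finset.exists_ne_zero_of_sum_ne_zero hx
  have : e.map (fun u => (u, f u)) = x := by
    by_contra hne
    exact he (Finsupp.single_eq_of_ne' hne)
  subst this
  obtain ⟨w, -, hw⟩ := Sym2.mem_map.1 hu
  simp only [Prod.mk.injEq] at hw
  obtain ⟨rfl, rfl⟩ := hw
  rfl

/-- If two colorings share the context of a gate, they agree on the vertices at the boundary of the
edge set of that gate. -/
theorem eq_of_mem_boundary {H : SimpleGraph V} {m' m₁ m₂ m₃ : Sym2 (V × Fin n) →₀ ℕ}
    {f₁ f₂ f₃ : V → Fin n} (h₁ : m' + m₁ = colMonomial H f₁) (h₂ : m' + m₂ = colMonomial H f₂)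
    (h₃ : m₃ + m₂ = colMonomial H f₃) {u : V} {e e' : Sym2 V} (hu : u ∈ e) (hu' : u ∈ e')
    (he' : e' ∈ H.edgeSet) (hm : patternEdges m₁ e ≠ 0) (hm' : patternEdges m₁ e' = 0) :
    f₁ u = f₃ u := by
  -- Both completed monomials project to the edge set of `H`, so the common context `m'` cancels.
  have hπ : patternEdges m₁ = patternEdges m₂ := by
    have := (patternEdges_colMonomial H f₁).trans (patternEdges_colMonomial H f₂).symm
    rw [← h₁, ← h₂, map_add, map_add] at this
    exact add_left_cancel this
  have h' : patternEdges m' e' ≠ 0 := by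
    have := patternEdges_colMonomial_ne_zero f₁ he'
    rwa [← h₁, map_add, Finsupp.add_apply, hm', add_zero] at this
  have left {a b : Sym2 (V × Fin n) →₀ ℕ} {x} (h : a x ≠ 0) : (a + b) x ≠ 0 := by
    rw [Finsupp.add_apply]; omega
  have right {a b : Sym2 (V × Fin n) →₀ ℕ} {x} (h : b x ≠ 0) : (a + b) x ≠ 0 := by
    rw [Finsupp.add_apply]; omega
  obtain ⟨i, x, hx, hi⟩ := exists_color_of_patternEdges_ne_zero h' hu'
  rw [hπ] at hm
  obtain ⟨j, y, hy, hj⟩ := exists_color_of_patternEdges_ne_zero hm hu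
  have h₁x : colMonomial H f₁ x ≠ 0 := h₁ ▸ left hx
  have h₂x : colMonomial H f₂ x ≠ 0 := h₂ ▸ left hx
  have h₂y : colMonomial H f₂ y ≠ 0 := h₂ ▸ right hy
  have h₃y : colMonomial H f₃ y ≠ 0 := h₃ ▸ right hy
  -- The hybrid coloring `f₂` links the other two: it shares the variable `x` at `u` with `f₁` and
  -- the variable `y` at `u` with `f₃`, so `f₁ u = i = f₂ u = j = f₃ u`.
  rw [eq_of_mem_of_colMonomial_ne_zero h₁x hi, eq_of_mem_of_colMonomial_ne_zero h₃y hj,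
    ← eq_of_mem_of_colMonomial_ne_zero h₂x hi, ← eq_of_mem_of_colMonomial_ne_zero h₂y hj]

end ColSub

/-! ### Rooted trees given by parent maps, and branching vertices. -/

/-- `p` sends every vertex of a rooted tree with root `0` to its parent, and the root to itself;
parents come first. -/
structure IsParentMap {k : ℕ} [NeZero k] (p : Fin k → Fin k) : Prop where
  map_zero : p 0 = 0
  map_lt : ∀ w, w ≠ 0 → p w < w

/-- The tree in which every vertex other than the root `0` is joined to its parent. -/
def parentGraph {k : ℕ} (p : Fin k → Fin k) : SimpleGraph (Fin k) :=
  SimpleGraph.fromRel fun u v => p u = v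

/-- The vertex `v` is the root of a `d`-ary tree of depth `j` in which every leaf has a further
child. -/
def IsBranching {k : ℕ} [NeZero k] (p : Fin k → Fin k) (d : ℕ) : ℕ → Fin k → Prop
  | 0, v => ∃ w, w ≠ 0 ∧ p w = v
  | j + 1, v => ∃ S : Finset (Fin k), d ≤ S.card ∧ ∀ w ∈ S, w ≠ 0 ∧ p w = v ∧ IsBranching p d j w

namespace IsParentMap

variable {k : ℕ} [NeZero k] {p : Fin k → Fin k} (hp : IsParentMap p)
include hp

theorem iterate_zero (t : ℕ) : p^[t] 0 = 0 :=
  Function.iterate_fixed hp.map_zero t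

theorem map_le (w : Fin k) : p w ≤ w := by
  by_cases hw : w = 0
  · rw [hw, hp.map_zero]
  · exact (hp.map_lt w hw).le

theorem iterate_le (t : ℕ) (w : Fin k) : p^[t] w ≤ w := by
  induction t with
  | zero => exact le_rfl
  | succ t ih => rw [Function.iterate_succ_apply']; exact (hp.map_le _).trans ih

theorem mem_edgeSet {w : Fin k} (hw : w ≠ 0) : s(w, p w) ∈ (parentGraph p).edgeSet := by
  rw [SimpleGraph.mem_edgeSet, parentGraph, SimpleGraph.fromRel_adj]
  exact ⟨(hp.map_lt w hw).ne', Or.inl rfl⟩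

theorem exists_of_mem_edgeSet {e : Sym2 (Fin k)} (he : e ∈ (parentGraph p).edgeSet) :
    ∃ w, w ≠ 0 ∧ s(w, p w) = e := by
  induction e using Sym2.ind with
  | _ a b =>
    rw [SimpleGraph.mem_edgeSet, parentGraph, SimpleGraph.fromRel_adj] at he
    obtain ⟨hab, h | h⟩ := he
    · refine ⟨a, fun h0 => hab ?_, by rw [h]⟩
      rw [← h, h0, hp.map_zero]
    · refine ⟨b, fun h0 => hab ?_, by rw [h, Sym2.eq_swap]⟩
      rw [← h, h0, hp.map_zero]

theorem edge_injOn : Set.InjOn (fun w => s(w, p w)) {w : Fin k | w ≠ 0} := by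
  intro a ha b hb h
  simp only [Sym2.eq_iff] at h
  obtain ⟨h, -⟩ | ⟨h1, h2⟩ := h
  · exact h
  · have h3 := hp.map_lt a ha
    have h4 := hp.map_lt b hb
    rw [h2] at h3
    rw [← h1] at h4
    exact absurd h3 h4.asymm

open Classical in
theorem edgeFinset_eq :
    (parentGraph p).edgeFinset = (Finset.univ.filter fun w => w ≠ 0).image fun w => s(w, p w) := by
  ext e
  simp only [SimpleGraph.mem_edgeFinset, Finset.mem_image, Finset.mem_filter, Finset.mem_univ,
    true_and]
  exact ⟨hp.exists_of_mem_edgeSet, fun ⟨w, hw, h⟩ => h ▸ hp.mem_edgeSet hw⟩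

theorem isTree : (parentGraph p).IsTree := by
  classical
  rw [SimpleGraph.isTree_iff_connected_and_card]
  constructor
  · have h (w : Fin k) : (parentGraph p).Reachable w 0 := by
      induction w using WellFoundedLT.induction with
      | _ w ih =>
        by_cases hw : w = 0
        · rw [hw]
        · exact (SimpleGraph.Adj.reachable (hp.mem_edgeSet hw)).trans (ih _ (hp.map_lt w hw))
    exact ⟨fun a b => (h a).trans (h b).symm⟩
  · rw [Nat.card_eq_fintype_card, ← SimpleGraph.edgeFinset_card, hp.edgeFinset_eq,
      Finset.card_image_of_injOn (fun a ha b hb => hp.edge_injOn (by simpa using ha)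
        (by simpa using hb)), Finset.filter_ne', Finset.card_erase_of_mem (Finset.mem_univ _),
      Finset.card_univ, Nat.card_eq_fintype_card, Fintype.card_fin]
    exact Nat.sub_add_cancel NeZero.one_le

/-- Each edge is indexed by its lower end `w ≠ 0`. The root contributes the dummy factor `1`, so the
product runs over all vertices. -/
theorem colSub_eq (n : ℕ) :
    colSub (parentGraph p) n = ∑ f : Fin k → Fin n, ∏ w, if w = 0 then 1 else
      X s((w, f w), (p w, f (p w))) := by
  classical
  unfold colSub
  refine Finset.sum_congr (by congr!) fun f _ => ?_
  rw [hp.edgeFinset_eq, Finset.prod_image fun a ha b hb => hp.edge_injOn (by simpa using ha)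
        (by simpa using hb), Finset.prod_filter]
  refine Finset.prod_congr rfl fun w _ => ?_
  by_cases hw : w = 0 <;> simp [hw]

/-- The subtrees at distinct children of a vertex are disjoint. -/
theorem eq_of_common_descendant {v w₁ w₂ u : Fin k} (h₁ : p w₁ = v) (h₂ : p w₂ = v)
    (hw₁ : w₁ ≠ 0) (hw₂ : w₂ ≠ 0) {a b : ℕ} (ha : p^[a] u = w₁) (hb : p^[b] u = w₂) :
    w₁ = w₂ := by
  wlog hab : a ≤ b generalizing a b w₁ w₂
  · exact (this h₂ h₁ hw₂ hw₁ hb ha (by omega)).symm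
  obtain ⟨c, rfl⟩ := Nat.exists_eq_add_of_le hab
  rw [add_comm, Function.iterate_add_apply, ha] at hb
  cases c with
  | zero => exact hb
  | succ c =>
    rw [Function.iterate_succ_apply, h₁] at hb
    have h3 := hp.iterate_le c v
    have h4 := hp.map_lt w₂ hw₂
    rw [hb] at h3
    rw [h₂] at h4
    exact absurd h4 h3.not_gt

end IsParentMap

namespace IsBranching

variable {k : ℕ} [NeZero k] {p : Fin k → Fin k} {d : ℕ}

theorem exists_child (hd : 0 < d) {j : ℕ} {v : Fin k} (h : IsBranching p d j v) :
    ∃ w, w ≠ 0 ∧ p w = v := by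
  cases j with
  | zero => exact h
  | succ j =>
    obtain ⟨S, hS, h⟩ := h
    obtain ⟨w, hw⟩ := Finset.card_pos.1 (hd.trans_le hS)
    exact ⟨w, (h w hw).1, (h w hw).2.1⟩

/-- A set of fewer than `d` vertices misses the subtree at some child of a branching vertex. -/
theorem exists_child_avoiding (hp : IsParentMap p) {j : ℕ} {v : Fin k}
    (h : IsBranching p d (j + 1) v) {U : Finset (Fin k)} (hU : U.card < d) :
    ∃ w, w ≠ 0 ∧ p w = v ∧ IsBranching p d j w ∧ ∀ u t, p^[t] u = w → u ∉ U := by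
  obtain ⟨S, hS, h⟩ := h
  by_contra! hcon
  have hex : ∀ w ∈ S, ∃ u ∈ U, ∃ t, p^[t] u = w := fun w hw => by
    obtain ⟨u, t, h1, h2⟩ := hcon w (h w hw).1 (h w hw).2.1 (h w hw).2.2
    exact ⟨u, h2, t, h1⟩
  choose! φ hφ t ht using hex
  -- Otherwise each of the `d` disjoint subtrees would contain its own element of `U`.
  have := Finset.card_le_card_of_injOn φ hφ fun a ha b hb hab =>
    hp.eq_of_common_descendant (h a ha).2.1 (h b hb).2.1 (h a ha).1 (h b hb).1 (ht a ha)
      (hab ▸ ht b hb)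
  omega

end IsBranching

/-! ### The lower bound: product gates with many boundary vertices, and counting colorings. -/

open Classical in
/-- The vertices that lie on an edge covered by some `μ h`, `h ∈ s`, and on another one that `μ h`
does not cover. -/
noncomputable def bag {V ι : Type} [Fintype V] {n : ℕ} (H : SimpleGraph V) (s : Finset ι)
    (μ : ι → Sym2 (V × Fin n) →₀ ℕ) : Finset V :=
  Finset.univ.filter fun u => ∃ h ∈ s, ∃ e e', u ∈ e ∧ u ∈ e' ∧ e' ∈ H.edgeSet ∧
    patternEdges (μ h) e ≠ 0 ∧ patternEdges (μ h) e' = 0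

theorem mem_bag {V ι : Type} [Fintype V] {n : ℕ} {H : SimpleGraph V} {s : Finset ι}
    {μ : ι → Sym2 (V × Fin n) →₀ ℕ} {u : V} : u ∈ bag H s μ ↔ ∃ h ∈ s, ∃ e e', u ∈ e ∧ u ∈ e' ∧
      e' ∈ H.edgeSet ∧ patternEdges (μ h) e ≠ 0 ∧ patternEdges (μ h) e' = 0 := by
  simp only [bag, Finset.mem_filter, Finset.mem_univ, true_and]

namespace AlgCircuit

variable {k n : ℕ} [NeZero k] {p : Fin k → Fin k} {d : ℕ}
  {C : AlgCircuit (Sym2 (Fin k × Fin n))}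

/-- A gate of small product-depth with a monomial that covers a branching subtree lies above a
product gate with a large bag. -/
theorem exists_mul_gate_of_isBranching (hp : IsParentMap p) (hd : 0 < d) (hC : C.IsMonotone)
    (g : C.V) {j : ℕ} (hj : C.gateDepth g ≤ j) {v : Fin k} (hv : IsBranching p d j v)
    {m m' : Sym2 (Fin k × Fin n) →₀ ℕ} (hm : m ∈ (C.gatePoly g).support) (hm' : C.Completes m' g)
    (hsub : ∀ u t, u ≠ 0 → p^[t + 1] u = v → patternEdges m s(u, p u) ≠ 0)
    (htwo : ∃ e e', e ≠ e' ∧ patternEdges m e ≠ 0 ∧ patternEdges m e' ≠ 0) :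
    ∃ g' s, C.gate g' = .mul s ∧ ∃ m'' μ, C.Completes m'' g' ∧
      (∀ h ∈ s, μ h ∈ (C.gatePoly h).support) ∧ m'' + ∑ h ∈ s, μ h = m' + m ∧
      d ≤ (bag (parentGraph p) s μ).card := by
  classical
  induction g using C.acyclic.induction generalizing j v m m' with
  | _ g ih =>
    obtain ⟨e₁, e₂, hne, he₁, he₂⟩ := htwo
    cases hg : C.gate g with
    | var x =>
      rw [C.gatePoly_of_var hg, support_X, Finset.mem_singleton] at hm
      subst hm
      rw [patternEdges, Finsupp.mapDomain.addMonoidHom_apply, Finsupp.mapDomain_single] at he₁ he₂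
      have hs {e : Sym2 (Fin k)} (he : Finsupp.single (x.map Prod.fst) 1 e ≠ 0) :
          e = x.map Prod.fst := by
        by_contra h
        exact he (Finsupp.single_eq_of_ne h)
      exact absurd ((hs he₁).trans (hs he₂).symm) hne
    | const a =>
      rw [C.gatePoly_of_const hg, mem_support_iff, coeff_C] at hm
      have : 0 = m := by by_contra hne; exact hm (if_neg hne)
      subst this
      rw [map_zero] at he₁
      exact absurd rfl he₁
    | add s =>
      rw [C.gatePoly_of_add hg] at hm
      obtain ⟨h, hh, hm⟩ := exists_of_mem_support_sum hm
      exact ih h (by rw [hg]; exact hh) ((C.gateDepth_le_of_add hg hh).trans hj) hv hm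
        (hm'.of_add hC hg hh) hsub ⟨e₁, e₂, hne, he₁, he₂⟩
    | mul s =>
      rw [C.gatePoly_of_mul hg] at hm
      obtain ⟨μ, hμ, rfl⟩ := exists_of_mem_support_prod hm
      by_cases hbag : d ≤ (bag (parentGraph p) s μ).card
      · exact ⟨g, s, hg, m', μ, hm', hμ, rfl, hbag⟩
      -- A product gate has positive depth, so a level of branching is still left.
      obtain ⟨j, rfl⟩ : ∃ i, j = i + 1 :=
        Nat.exists_eq_add_one.2 ((C.gateDepth_pos_of_mul hg).trans_le hj)
      obtain ⟨w, hw0, hwv, hw, hU⟩ := hv.exists_child_avoiding hp (not_le.1 hbag)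
      obtain ⟨h, hh, hhw⟩ : ∃ h ∈ s, patternEdges (μ h) s(w, p w) ≠ 0 := by
        have := hsub w 0 hw0 hwv
        rw [map_sum, Finsupp.finsetSum_apply] at this
        exact Finset.exists_ne_zero_of_sum_ne_zero this
      -- Coverage by `h` spreads downwards from the edge above `w`: the first edge missed would put
      -- its upper end, a vertex of the subtree at `w`, into the bag.
      have hcov : ∀ t u, p^[t] u = w → patternEdges (μ h) s(u, p u) ≠ 0 := by
        intro t
        induction t with
        | zero => rintro u rfl; exact hhw
        | succ t iht =>
          intro u hu h0
          have hu0 : u ≠ 0 := by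
            rintro rfl
            exact hw0 (hu.symm.trans (hp.iterate_zero _))
          have hmem : p u ∈ bag (parentGraph p) s μ := mem_bag.2 ⟨h, hh, s(p u, p (p u)), s(u, p u),
            Sym2.mem_mk_left _ _, Sym2.mem_mk_right _ _, hp.mem_edgeSet hu0, iht (p u) hu, h0⟩
          exact hU (p u) t hu hmem
      -- Even at the last level `w` has a child, thanks to the pendant vertices. The two edges at
      -- `w` keep the trace from ending in an input gate.
      obtain ⟨u, hu0, huw⟩ := hw.exists_child hd
      have hne : s(w, p w) ≠ s(u, p u) := fun he =>
        (hp.map_lt u hu0).ne (huw.trans (hp.edge_injOn hw0 hu0 he))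
      have hdh : C.gateDepth h ≤ j :=
        Nat.le_of_lt_succ ((C.gateDepth_lt_of_mul hg hh).trans_le hj)
      obtain ⟨g', s', hg', m'', μ', h1, h2, h3, h4⟩ := ih h (by rw [hg]; exact hh) hdh hw
        (hμ h hh) (hm'.of_mul hC hg hh hμ) (fun u t _ hu => hcov (t + 1) u hu)
        ⟨s(w, p w), s(u, p u), hne, hhw, hcov 1 u huw⟩
      refine ⟨g', s', hg', m'', μ', h1, h2, h3.trans ?_, h4⟩
      rw [add_assoc, Finset.sum_erase_add _ _ hh]

/-- At most `k - d` coordinates stay free. The multiplied form avoids truncated subtraction. -/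
theorem card_agreeing_le (f : Fin k → Fin n) {U : Finset (Fin k)} (hU : d ≤ U.card) :
    (Finset.univ.filter fun f' : Fin k → Fin n => ∀ u ∈ U, f' u = f u).card * n ^ d ≤ n ^ k := by
  classical
  have hn : 0 < n := (f 0).pos
  have : (Finset.univ.filter fun f' : Fin k → Fin n => ∀ u ∈ U, f' u = f u) =
      Fintype.piFinset fun u => if u ∈ U then {f u} else Finset.univ := by
    ext f'
    simp only [Finset.mem_filter, Finset.mem_univ, true_and, Fintype.mem_piFinset]
    refine forall_congr' fun u => ?_
    by_cases hu : u ∈ U <;> simp [hu]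
  rw [this, Fintype.card_piFinset]
  calc _ ≤ (∏ u, if u ∈ U then 1 else n) * n ^ U.card := by
        refine Nat.mul_le_mul (Finset.prod_le_prod' fun u _ => ?_) (Nat.pow_le_pow_right hn hU)
        by_cases hu : u ∈ U <;> simp [hu]
    _ = (∏ u, if u ∈ U then 1 else n) * ∏ u : Fin k, if u ∈ U then n else 1 := by
        rw [Finset.prod_ite_mem, Finset.univ_inter, Finset.prod_const]
    _ = n ^ k := by
        rw [← Finset.prod_mul_distrib]
        have : ∀ u ∈ Finset.univ,
            ((if u ∈ U then 1 else n) * if u ∈ U then n else 1) = n := fun u _ => by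
          by_cases hu : u ∈ U <;> simp [hu]
        rw [Finset.prod_congr rfl this, Finset.prod_const, Finset.card_univ, Fintype.card_fin]
    _ ≤ _ := le_rfl

theorem pow_le_size_of_isBranching (hp : IsParentMap p) (hd : 2 ≤ d) {Δ : ℕ} (hΔ : 1 ≤ Δ)
    (hroot : IsBranching p d Δ 0) (hC : C.IsMonotone) (hdepth : C.productDepth ≤ Δ)
    (hpoly : C.poly = colSub (parentGraph p) n) (hn : 1 ≤ n) : n ^ d ≤ C.size := by
  classical
  have hsupp {m} : m ∈ C.poly.support ↔ ∃ f : Fin k → Fin n, colMonomial (parentGraph p) f = m := by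
    rw [hpoly, mem_support_colSub]
  have hedge (f : Fin k → Fin n) {u : Fin k} (hu : u ≠ 0) :
      patternEdges (colMonomial (parentGraph p) f) s(u, p u) ≠ 0 :=
    patternEdges_colMonomial_ne_zero f (hp.mem_edgeSet hu)
  have key (f : Fin k → Fin n) := by
    refine C.exists_mul_gate_of_isBranching hp (by omega) hC C.output hdepth hroot
      (m := colMonomial (parentGraph p) f) (m' := 0) (hsupp.2 ⟨f, rfl⟩)
      (fun m hm => by rwa [zero_add]) (fun u t hu _ => hedge f hu) ?_
    obtain ⟨j, rfl⟩ : ∃ i, Δ = i + 1 := Nat.exists_eq_add_one.2 hΔ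
    obtain ⟨S, hS, h⟩ := hroot
    obtain ⟨a, ha, b, hb, hab⟩ := Finset.one_lt_card.1 (lt_of_lt_of_le hd hS)
    exact ⟨_, _, fun he => hab (hp.edge_injOn (h a ha).1 (h b hb).1 he), hedge f (h a ha).1,
      hedge f (h b hb).1⟩
  simp only [zero_add] at key
  choose G s hG m' μ hm' hμ hsum hbag using key
  have hfib (g : C.V) : (Finset.univ.filter fun f => G f = g).card * n ^ d ≤ n ^ k := by
    rcases (Finset.univ.filter fun f => G f = g).eq_empty_or_nonempty with h | ⟨f₀, h₀⟩
    · rw [h]; simp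
    refine (Nat.mul_le_mul_right _ (Finset.card_le_card fun f hf => ?_)).trans
      (card_agreeing_le f₀ (hbag f₀))
    simp only [Finset.mem_filter, Finset.mem_univ, true_and] at h₀ hf ⊢
    intro u hu
    obtain ⟨h, hh, e, e', hue, hue', he', h1, h2⟩ := mem_bag.1 hu
    -- Both traces end at the same gate, so `h` is a child in both and its monomials can be swapped.
    have hs : s f₀ = s f := by
      have h3 := hG f₀
      have h4 := hG f
      rw [h₀] at h3
      rw [hf, h3] at h4
      exact GateLabel.mul.inj h4
    have hhf : h ∈ s f := hs ▸ hh
    have hcomp := (hm' f₀).of_mul hC (hG f₀) hh (hμ f₀)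
    obtain ⟨f₂, hf₂⟩ := hsupp.1 (hcomp (μ f h) (hμ f h hhf))
    refine (eq_of_mem_boundary (m' := m' f₀ + ∑ i ∈ (s f₀).erase h, μ f₀ i) (m₁ := μ f₀ h)
      (m₂ := μ f h) (m₃ := m' f + ∑ i ∈ (s f).erase h, μ f i) ?_ hf₂.symm ?_
      hue hue' he' h1 h2).symm
    · rw [add_assoc, Finset.sum_erase_add _ _ hh, hsum]
    · rw [add_assoc, Finset.sum_erase_add _ _ hhf, hsum]
  have htotal : n ^ k * n ^ d ≤ C.size * n ^ k := by
    calc n ^ k * n ^ d = (Finset.univ : Finset (Fin k → Fin n)).card * n ^ d := by simp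
      _ = ∑ g : C.V, (Finset.univ.filter fun f => G f = g).card * n ^ d := by
          rw [← Finset.sum_mul]
          congr 1
          exact Finset.card_eq_sum_card_fiberwise fun f _ => Finset.mem_coe.2 (Finset.mem_univ (G f))
      _ ≤ ∑ g : C.V, n ^ k := Finset.sum_le_sum fun g _ => hfib g
      _ = C.size * n ^ k := by rw [Finset.sum_const, smul_eq_mul]; rfl
  rw [mul_comm] at htotal
  exact Nat.le_of_mul_le_mul_right htotal (pow_pos hn k)

/-- The `n` monochromatic colorings use `n` different variables at one edge, each needing its own
input gate. This bound serves the patterns too small for branching with `d ≥ 2`. -/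
theorem le_size_of_colSub {V : Type} [Fintype V] {C : AlgCircuit (Sym2 (V × Fin n))}
    {H : SimpleGraph V} {a b : V} (hab : H.Adj a b) (hpoly : C.poly = colSub H n) :
    n ≤ C.size := by
  classical
  have key (i : Fin n) : ∃ g, C.gate g = .var s((a, i), (b, i)) := by
    have hm : colMonomial H (fun _ => i) ∈ (C.gatePoly C.output).support := by
      change _ ∈ C.poly.support
      rw [hpoly, mem_support_colSub]
      exact ⟨_, rfl⟩
    refine exists_var_gate C.output hm ?_
    rw [colMonomial, Finsupp.finsetSum_apply]
    refine (Finset.sum_pos' (fun _ _ => Nat.zero_le _)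
      ⟨s(a, b), SimpleGraph.mem_edgeFinset.2 hab, ?_⟩).ne'
    simp
  choose G hG using key
  have hinj : Function.Injective G := fun i j hij => by
    have := hG i
    rw [hij, hG j] at this
    have := GateLabel.var.inj this
    simp only [Sym2.eq_iff, Prod.mk.injEq] at this
    rcases this with h | h
    · exact h.1.2.symm
    · exact h.1.2.symm
  simpa [size] using Fintype.card_le_of_injective G hinj

end AlgCircuit

/-! ### Dynamic programming over a rooted tree. -/

section SumOverColorings

variable {k n : ℕ} {R : Type} [CommSemiring R]

open Classical in
/-- The colorings of the first `t` vertices, with the fixed color `c` on the other vertices. -/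
noncomputable def prefixColorings (k : ℕ) (c : Fin n) (t : ℕ) : Finset (Fin k → Fin n) :=
  Fintype.piFinset fun v => if v.val < t then Finset.univ else {c}

theorem mem_prefixColorings {c : Fin n} {t : ℕ} {f : Fin k → Fin n} :
    f ∈ prefixColorings k c t ↔ ∀ v, t ≤ v.val → f v = c := by
  simp only [prefixColorings, Fintype.mem_piFinset]
  refine forall_congr' fun v => ?_
  by_cases hv : v.val < t
  · simp [hv]
  · simp [hv, not_lt.1 hv]

open Classical in
theorem sum_prefixColorings_succ (c : Fin n) (v : Fin k) (g : (Fin k → Fin n) → R) :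
    ∑ f ∈ prefixColorings k c (v + 1), g f =
      ∑ f ∈ prefixColorings k c v, ∑ j, g (Function.update f v j) := by
  rw [← Finset.sum_product']
  symm
  refine Finset.sum_nbij' (fun x => Function.update x.1 v x.2)
    (fun f => (Function.update f v c, f v)) ?_ ?_ ?_ ?_ ?_
  · rintro ⟨f, j⟩ h
    simp only [Finset.mem_product, mem_prefixColorings, Finset.mem_univ, and_true] at h ⊢
    intro u hu
    rw [Function.update_of_ne (by rintro rfl; omega)]
    exact h u (by omega)
  · intro f h
    simp only [Finset.mem_product, mem_prefixColorings, Finset.mem_univ, and_true] at h ⊢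
    intro u hu
    by_cases huv : u = v
    · subst huv; simp
    · rw [Function.update_of_ne huv]
      exact h u (by have : u.val ≠ v.val := fun h => huv (Fin.ext h); omega)
  · rintro ⟨f, j⟩ h
    simp only [Finset.mem_product, mem_prefixColorings, Finset.mem_univ, and_true] at h
    simp only [Function.update_idem, Function.update_self, Prod.mk.injEq, and_true]
    rw [← h v le_rfl, Function.update_eq_self]
  · intro f _
    simp
  · intro x _
    rfl

open Classical in
/-- Sums and products along a rooted tree, from the leaves to the root, give the sum over all
colorings of the product over all edges. -/
theorem IsParentMap.sum_prod_children_eq [NeZero k] {p : Fin k → Fin k} (hp : IsParentMap p)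
    (hn : 1 ≤ n) (x : Fin k → Fin n → Fin n → R) (S : Fin k → Fin n → R)
    (hS : ∀ w, w ≠ 0 → ∀ i, S w i =
      ∑ j, x w i j * ∏ u ∈ Finset.univ.filter (fun u => u ≠ 0 ∧ p u = w), S u j) :
    ∑ i, ∏ u ∈ Finset.univ.filter (fun u => u ≠ 0 ∧ p u = 0), S u i =
      ∑ f : Fin k → Fin n, ∏ w, if w = 0 then 1 else x w (f (p w)) (f w) := by
  let c : Fin n := ⟨0, hn⟩
  -- Invariant: after coloring the first `t` vertices, edges among them contribute their own factor,
  -- edges leaving them contribute a whole partial sum `S`, and all other edges are still inside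
  -- those sums.
  let T : ℕ → (Fin k → Fin n) → R := fun t f => ∏ w : Fin k, if w = 0 then 1 else
    if w.val < t then x w (f (p w)) (f w) else if (p w).val < t then S w (f (p w)) else 1
  have key : ∀ t, t + 1 ≤ k → ∑ f ∈ prefixColorings k c (t + 1), T (t + 1) f =
      ∑ i, ∏ u ∈ Finset.univ.filter (fun u => u ≠ 0 ∧ p u = 0), S u i := by
    intro t
    induction t with
    | zero =>
      intro hk
      have h0 : prefixColorings k c (0 : Fin k).val = {fun _ => c} := by
        ext f
        rw [mem_prefixColorings, Finset.mem_singleton]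
        exact ⟨fun h => funext fun v => h v (Nat.zero_le _), fun h v _ => congrFun h v⟩
      rw [show (0 : ℕ) + 1 = (0 : Fin k).val + 1 from rfl, sum_prefixColorings_succ, h0,
        Finset.sum_singleton]
      refine Finset.sum_congr rfl fun i _ => ?_
      rw [Finset.prod_filter]
      refine Finset.prod_congr rfl fun w _ => ?_
      by_cases hw : w = 0
      · simp [hw]
      · have hw' : w.val ≠ 0 := fun h => hw (Fin.ext h)
        by_cases hpw : p w = 0
        · simp [hw, hpw, hw']
        · have hpw' : (p w).val ≠ 0 := fun h => hpw (Fin.ext h)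
          simp [hw, hpw, hw', hpw']
    | succ t ih =>
      intro hk
      rw [← ih (by omega)]
      let v : Fin k := ⟨t + 1, by omega⟩
      have hv0 : v ≠ 0 := fun h => by have := congrArg Fin.val h; simp [v] at this
      rw [show t + 1 + 1 = v.val + 1 from rfl, sum_prefixColorings_succ]
      refine Finset.sum_congr rfl fun f _ => ?_
      -- The factors unaffected by coloring `v`. Passing from `T (t + 1)` to `T (t + 2)` only
      -- unfolds `S v` by its recursion, because parents precede children.
      let r : Fin k → R := fun w => if w = 0 then 1 else if w.val < v.val then
        x w (f (p w)) (f w) else if w = v then 1 else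
          if (p w).val < v.val then S w (f (p w)) else 1
      have hT : T (t + 1) f = S v (f (p v)) * ∏ w, r w := by
        have h1 : S v (f (p v)) = ∏ w, if w = v then S w (f (p w)) else 1 := by
          rw [Finset.prod_ite_eq' Finset.univ v]; simp
        rw [h1, ← Finset.prod_mul_distrib]
        refine Finset.prod_congr rfl fun w _ => ?_
        by_cases hwv : w = v
        · have h2 := hp.map_lt v hv0
          rw [Fin.lt_def] at h2
          subst hwv
          simp [r, hv0, show (p v).val < t + 1 from h2, v]
        · simp [r, hwv, v]
      have hT' (j : Fin n) : T (v.val + 1) (Function.update f v j) = (x v (f (p v)) j *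
          ∏ u ∈ Finset.univ.filter (fun u => u ≠ 0 ∧ p u = v), S u j) * ∏ w, r w := by
        have h1 : x v (f (p v)) j = ∏ w, if w = v then x w (f (p w)) j else 1 := by
          rw [Finset.prod_ite_eq' Finset.univ v]; simp
        rw [h1, Finset.prod_filter, ← Finset.prod_mul_distrib, ← Finset.prod_mul_distrib]
        refine Finset.prod_congr rfl fun w _ => ?_
        by_cases hw0 : w = 0
        · simp [hw0, hv0.symm, r]
        have h2 := hp.map_lt w hw0
        rw [Fin.lt_def] at h2
        rcases lt_trichotomy w.val v.val with h | h | h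
        · have hwv : w ≠ v := fun e => by rw [e] at h; exact lt_irrefl _ h
          have hpv : p w ≠ v := fun e => by rw [e] at h2; omega
          simp [r, hw0, Fin.lt_def.2 h, hwv, hpv, Nat.lt_succ_of_lt h]
        · obtain rfl : w = v := Fin.ext h
          have hpv : p v ≠ v := fun e => by rw [e] at h2; omega
          simp [r, hv0, hpv]
        · have hwv : w ≠ v := fun e => by rw [e] at h; exact lt_irrefl _ h
          by_cases hpv : p w = v
          · simp [r, hw0, hwv, hpv, (Fin.lt_def.2 h).not_gt, show ¬ w.val < v.val + 1 by omega]
          · have hpv' : (p w).val ≠ v.val := fun h => hpv (Fin.ext h)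
            have : (p w).val < v.val + 1 ↔ (p w).val < v.val := by omega
            simp only [r, hw0, hwv, hpv, not_lt.2 h.le, show ¬ w.val < v.val + 1 by omega, this,
              if_false, Function.update_of_ne hpv, ne_eq, not_false_eq_true, and_false, mul_one,
              one_mul]
      rw [hT, hS v hv0, Finset.sum_mul]
      exact Finset.sum_congr rfl fun j _ => hT' j
  obtain ⟨t, rfl⟩ := Nat.exists_eq_add_one.2 (NeZero.pos k)
  rw [← key t le_rfl]
  have huniv : prefixColorings (t + 1) c (t + 1) = Finset.univ := by
    ext f
    simp only [mem_prefixColorings, Finset.mem_univ, iff_true]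
    intro v hv
    exact absurd v.isLt (by omega)
  rw [huniv]
  refine Finset.sum_congr rfl fun f _ => Finset.prod_congr rfl fun w _ => ?_
  simp [w.isLt]

end SumOverColorings

/-! ### The layered circuit for the upper bound. -/

/-- The gates of the tree circuit: the output, and below it gates for the root and for the
partial sums and products at the edge from `w` to its parent, given the colors of its ends. -/
inductive TreeGate {k : ℕ} [NeZero k] (p : Fin k → Fin k) (n : ℕ) : Type where
  | out
  | root (i : Fin n)
  | sum (w : {w : Fin k // w ≠ 0}) (i : Fin n)
  | edge (w : {w : Fin k // w ≠ 0}) (i j : Fin n)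
  | var (w : {w : Fin k // w ≠ 0 ∧ ∃ u, u ≠ 0 ∧ p u = w}) (i j : Fin n)

namespace TreeGate

variable {k n : ℕ} [NeZero k] {p : Fin k → Fin k}

/-- An encoding of the gates by tuples. -/
def code : TreeGate p n → Unit ⊕ Fin n ⊕ (Fin k × Fin n) ⊕ (Fin k × Fin n × Fin n) ⊕
    (Fin k × Fin n × Fin n)
  | out => .inl ()
  | root i => .inr (.inl i)
  | sum w i => .inr (.inr (.inl (w, i)))
  | edge w i j => .inr (.inr (.inr (.inl (w, i, j))))
  | var w i j => .inr (.inr (.inr (.inr (w, i, j))))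

theorem code_injective : Function.Injective (code : TreeGate p n → _) := by
  intro a b h
  cases a <;> cases b <;> simp_all [code, Subtype.ext_iff]

noncomputable instance : Fintype (TreeGate p n) := Fintype.ofInjective code code_injective

theorem card_le : Fintype.card (TreeGate p n) ≤ 1 + (n + (k * n + (k * (n * n) + k * (n * n)))) := by
  have := Fintype.card_le_of_injective (code : TreeGate p n → _) code_injective
  simpa using this

/-- The product-depth of a gate is at most its height, if the tree has `L` levels below the root. -/
def height (lev : Fin k → ℕ) (L : ℕ) : TreeGate p n → ℕ
  | out => L
  | root _ => L
  | sum w _ => L - lev w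
  | edge w _ _ => L - lev w
  | var _ _ _ => 0

/-- The layer of a gate. -/
def layer (lev : Fin k → ℕ) : TreeGate p n → ℕ
  | out => 0
  | root _ => 1
  | sum w _ => 2 * lev w
  | edge w _ _ => 2 * lev w + 1
  | var w _ _ => 2 * lev w + 2

open Classical in
/-- The partial sums at the children of `v`, given the color of `v`. -/
noncomputable def childSums (v : Fin k) (i : Fin n) : Finset (TreeGate p n) :=
  (Finset.univ.filter fun u : {u : Fin k // u ≠ 0} => p u = v).image fun u => sum u i

theorem mem_childSums {v : Fin k} {i : Fin n} {g : TreeGate p n} :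
    g ∈ childSums v i ↔ ∃ u : {u : Fin k // u ≠ 0}, p u = v ∧ sum u i = g := by
  simp [childSums]

open Classical in
/-- The labels of the gates. -/
noncomputable def label : TreeGate p n → GateLabel (Sym2 (Fin k × Fin n)) (TreeGate p n)
  | out => .add (Finset.univ.image root)
  | root i => .mul (childSums 0 i)
  | sum w i => .add (Finset.univ.image (edge w i))
  | edge w i j =>
    -- At a leaf the gate is the variable itself, which saves a product layer at the bottom. At an
    -- inner vertex the variable gets its own gate, next to the sums at the children, so that
    -- layering is preserved.
    if h : ∃ u, u ≠ 0 ∧ p u = w then .mul (insert (var ⟨w, w.2, h⟩ i j) (childSums w j))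
    else .var s((w.1, j), (p w, i))
  | var w i j => .var s((w.1, j), (p w, i))

theorem mem_children_out {g : TreeGate p n} :
    g ∈ (label (out : TreeGate p n)).children ↔ ∃ i, root i = g := by
  simp [label, GateLabel.children]

theorem mem_children_root {g : TreeGate p n} {i : Fin n} :
    g ∈ (label (root i)).children ↔ g ∈ childSums 0 i := Iff.rfl

theorem mem_children_sum {g : TreeGate p n} {w : {w : Fin k // w ≠ 0}} {i : Fin n} :
    g ∈ (label (sum w i)).children ↔ ∃ j, edge w i j = g := by
  simp [label, GateLabel.children]

theorem mem_children_edge {g : TreeGate p n} {w : {w : Fin k // w ≠ 0}} {i j : Fin n} :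
    g ∈ (label (edge w i j)).children ↔
      (∃ h : ∃ u, u ≠ 0 ∧ p u = w, g = var ⟨w, w.2, h⟩ i j) ∨ g ∈ childSums w j := by
  by_cases h : ∃ u, u ≠ 0 ∧ p u = w
  · simp only [label, dif_pos h, GateLabel.children, Finset.mem_insert]
    exact ⟨fun hg => hg.imp_left fun hg => ⟨h, hg⟩, fun hg => hg.imp_left fun hg => hg.2⟩
  · simp only [label, dif_neg h, GateLabel.children, Finset.notMem_empty, false_iff, not_or]
    refine ⟨fun hg => h hg.1, fun hg => ?_⟩
    obtain ⟨u, hu, -⟩ := mem_childSums.1 hg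
    exact h ⟨u, u.2, hu⟩

theorem layer_child {lev : Fin k → ℕ} (h0 : lev 0 = 0) (hlev : ∀ w, w ≠ 0 → lev w = lev (p w) + 1)
    {g h : TreeGate p n} (hh : h ∈ (label g).children) : layer lev h = layer lev g + 1 := by
  cases g with
  | out => obtain ⟨i, rfl⟩ := mem_children_out.1 hh; rfl
  | root i =>
    obtain ⟨u, hu, rfl⟩ := mem_childSums.1 (mem_children_root.1 hh)
    simp [layer, hlev u u.2, hu, h0]
  | sum w i => obtain ⟨j, rfl⟩ := mem_children_sum.1 hh; rfl
  | edge w i j =>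
    rcases mem_children_edge.1 hh with ⟨_, rfl⟩ | hh
    · rfl
    · obtain ⟨u, hu, rfl⟩ := mem_childSums.1 hh
      simp only [layer, hlev u u.2, hu]
      ring
  | var w i j => exact absurd hh (Finset.notMem_empty _)

theorem layer_le {lev : Fin k → ℕ} {L : ℕ} (hL : ∀ w, lev w ≤ L) (g : TreeGate p n) :
    layer lev g ≤ 2 * L + 2 := by
  cases g with
  | out => simp [layer]
  | root i => simp [layer]
  | sum w i => have := hL w; simp only [layer]; omega
  | edge w i j => have := hL w; simp only [layer]; omega
  | var w i j => have := hL w; simp only [layer]; omega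

theorem wellFounded_children {lev : Fin k → ℕ} {L : ℕ} (h0 : lev 0 = 0)
    (hlev : ∀ w, w ≠ 0 → lev w = lev (p w) + 1) (hL : ∀ w, lev w ≤ L) :
    WellFounded fun h g : TreeGate p n => h ∈ (label g).children := by
  refine Subrelation.wf (r := (measure fun g : TreeGate p n => 2 * L + 2 - layer lev g).rel) ?_
    (measure fun g : TreeGate p n => 2 * L + 2 - layer lev g).wf
  intro h g hh
  have h1 := layer_child h0 hlev hh
  have h2 := layer_le hL h
  change 2 * L + 2 - layer lev h < 2 * L + 2 - layer lev g
  omega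

end TreeGate

open TreeGate in
/-- The circuit that evaluates `colSub` of a rooted tree from the leaves to the root. -/
noncomputable def treeCircuit {k n : ℕ} [NeZero k] {p : Fin k → Fin k} {lev : Fin k → ℕ} {L : ℕ}
    (h0 : lev 0 = 0) (hlev : ∀ w, w ≠ 0 → lev w = lev (p w) + 1) (hL : ∀ w, lev w ≤ L)
    (hn : 1 ≤ n) (hroot : ∃ u, u ≠ 0 ∧ p u = 0) : AlgCircuit (Sym2 (Fin k × Fin n)) where
  V := TreeGate p n
  gate := label
  output := out
  acyclic := wellFounded_children h0 hlev hL
  nonempty_of_inner g hg := by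
    cases g with
    | out => exact ⟨_, mem_children_out.2 ⟨⟨0, hn⟩, rfl⟩⟩
    | root i =>
      obtain ⟨u, hu, hu0⟩ := hroot
      exact ⟨_, mem_children_root.2 (mem_childSums.2 ⟨⟨u, hu⟩, hu0, rfl⟩)⟩
    | sum w i => exact ⟨_, mem_children_sum.2 ⟨⟨0, hn⟩, rfl⟩⟩
    | edge w i j =>
      by_cases h : ∃ u, u ≠ 0 ∧ p u = w
      · exact ⟨_, mem_children_edge.2 (Or.inl ⟨h, rfl⟩)⟩
      · simp [label, dif_neg h, GateLabel.IsAdd, GateLabel.IsMul] at hg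
    | var w i j => simp [label, GateLabel.IsAdd, GateLabel.IsMul] at hg

section TreeCircuit

open TreeGate

variable {k n : ℕ} [NeZero k] {p : Fin k → Fin k} {lev : Fin k → ℕ} {L : ℕ}
    (h0 : lev 0 = 0) (hlev : ∀ w, w ≠ 0 → lev w = lev (p w) + 1) (hL : ∀ w, lev w ≤ L)
    (hn : 1 ≤ n) (hroot : ∃ u, u ≠ 0 ∧ p u = 0)

theorem treeCircuit_isMonotone : (treeCircuit h0 hlev hL hn hroot).IsMonotone := by
  intro g a hg
  change label g = .const a at hg
  cases g with
  | out => cases hg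
  | root i => cases hg
  | sum w i => cases hg
  | edge w i j => rw [label] at hg; split_ifs at hg
  | var w i j => cases hg

theorem treeCircuit_isLayered : (treeCircuit h0 hlev hL hn hroot).IsLayered where
  layers := ⟨layer lev, rfl, fun g h hh => layer_child h0 hlev hh⟩
  unique_root g hg := by
    change TreeGate p n at g
    change ∃ q : TreeGate p n, g ∈ (label q).children
    cases g with
    | out => exact absurd rfl hg
    | root i => exact ⟨out, mem_children_out.2 ⟨i, rfl⟩⟩
    | sum w i =>
      by_cases h : p w = 0
      · exact ⟨root i, mem_children_root.2 (mem_childSums.2 ⟨w, h, rfl⟩)⟩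
      · exact ⟨edge ⟨p w, h⟩ ⟨0, hn⟩ i,
          mem_children_edge.2 (Or.inr (mem_childSums.2 ⟨w, rfl, rfl⟩))⟩
    | edge w i j => exact ⟨sum w i, mem_children_sum.2 ⟨j, rfl⟩⟩
    | var w i j => exact ⟨edge ⟨w, w.2.1⟩ i j, mem_children_edge.2 (Or.inl ⟨w.2.2, rfl⟩)⟩
  add_alternate g hg h hh := by
    change TreeGate p n at g h
    change h ∈ (label g).children at hh
    change ¬ (label h).IsAdd
    cases g with
    | out => obtain ⟨i, rfl⟩ := mem_children_out.1 hh; exact id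
    | root i => exact absurd hg id
    | sum w i =>
      obtain ⟨j, rfl⟩ := mem_children_sum.1 hh
      rw [label]
      split_ifs <;> exact id
    | edge w i j =>
      change (label (edge w i j)).IsAdd at hg
      rw [label] at hg
      split_ifs at hg <;> exact absurd hg id
    | var w i j => exact absurd hg id
  mul_alternate g hg h hh := by
    change TreeGate p n at g h
    change h ∈ (label g).children at hh
    change ¬ (label h).IsMul
    cases g with
    | out => exact absurd hg id
    | root i =>
      obtain ⟨u, hu, rfl⟩ := mem_childSums.1 (mem_children_root.1 hh)
      exact id
    | sum w i => exact absurd hg id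
    | edge w i j =>
      rcases mem_children_edge.1 hh with ⟨_, rfl⟩ | hh
      · exact id
      · obtain ⟨u, hu, rfl⟩ := mem_childSums.1 hh
        exact id
    | var w i j => exact absurd hg id

theorem treeCircuit_productDepth_le : (treeCircuit h0 hlev hL hn hroot).productDepth ≤ L := by
  have hpos : ∀ u, u ≠ 0 → lev (p u) < L := fun u hu => by
    have := hL u
    rw [hlev u hu] at this
    exact this
  refine AlgCircuit.gateDepth_le_of_potential (treeCircuit h0 hlev hL hn hroot)
    (height (p := p) (n := n) lev L) ?_ ?_ out
  · intro g s hg h hh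
    change TreeGate p n at g h
    change label g = .add s at hg
    have hh : h ∈ (label g).children := by rw [hg]; exact hh
    cases g with
    | out => obtain ⟨i, rfl⟩ := mem_children_out.1 hh; exact le_rfl
    | root i => cases hg
    | sum w i => obtain ⟨j, rfl⟩ := mem_children_sum.1 hh; exact le_rfl
    | edge w i j => rw [label] at hg; split_ifs at hg
    | var w i j => cases hg
  · intro g s hg
    change TreeGate p n at g
    change label g = .mul s at hg
    have hs : ∀ h ∈ s, h ∈ (label g).children := fun h hh => by rw [hg]; exact hh
    cases g with
    | out => cases hg
    | root i =>
      obtain ⟨u, hu0, hu⟩ := hroot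
      refine ⟨Nat.zero_lt_of_lt (hpos u hu0), fun h hh => ?_⟩
      obtain ⟨w, hw, rfl⟩ := mem_childSums.1 (mem_children_root.1 (hs h hh))
      have h1 := hlev w w.2
      have h2 := hL w
      simp only [height]
      omega
    | sum w i => cases hg
    | edge w i j =>
      have hw : ∃ u, u ≠ 0 ∧ p u = w := by
        by_contra hw
        rw [label, dif_neg hw] at hg
        cases hg
      obtain ⟨u, hu0, hu⟩ := hw
      have h3 := hpos u hu0
      rw [hu] at h3
      refine ⟨Nat.sub_pos_of_lt h3, fun h hh => ?_⟩
      rcases mem_children_edge.1 (hs h hh) with ⟨_, rfl⟩ | hh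
      · exact Nat.sub_pos_of_lt h3
      · obtain ⟨y, hy, rfl⟩ := mem_childSums.1 hh
        have h1 := hlev y y.2
        rw [hy] at h1
        simp only [height]
        omega
    | var w i j => cases hg

/-- There are five kinds of gates, each with at most `n ^ 2 * k` members. -/
theorem treeCircuit_size_le : (treeCircuit h0 hlev hL hn hroot).size ≤ 5 * (n ^ 2 * k) := by
  refine (card_le (p := p) (n := n)).trans ?_
  have hk : 1 ≤ k := NeZero.one_le
  have h1 : n ≤ n * n := Nat.le_mul_of_pos_left n hn
  have h2 : n * n ≤ k * (n * n) := Nat.le_mul_of_pos_left _ hk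
  have h3 : k * n ≤ k * (n * n) := Nat.mul_le_mul_left k h1
  have h4 : n ^ 2 * k = k * (n * n) := by ring
  rw [h4]
  omega

theorem treeCircuit_poly (hp : IsParentMap p) :
    (treeCircuit h0 hlev hL hn hroot).poly = colSub (parentGraph p) n := by
  classical
  set C := treeCircuit h0 hlev hL hn hroot with hC
  let G : TreeGate p n → MvPolynomial (Sym2 (Fin k × Fin n)) ℚ := C.gatePoly
  -- The root has no edge to a parent; its value `1` is never used.
  let S : Fin k → Fin n → MvPolynomial (Sym2 (Fin k × Fin n)) ℚ := fun w i =>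
    if h : w ≠ 0 then G (sum ⟨w, h⟩ i) else 1
  have hchild (v : Fin k) (i : Fin n) : ∏ g ∈ childSums v i, G g =
      ∏ u ∈ Finset.univ.filter (fun u => u ≠ 0 ∧ p u = v), S u i := by
    rw [childSums, Finset.prod_image (by intro a _ b _ h; injection h)]
    refine Finset.prod_bij (fun u _ => u.1) ?_ ?_ ?_ ?_
    · intro u hu
      simp only [Finset.mem_filter, Finset.mem_univ, true_and] at hu ⊢
      exact ⟨u.2, hu⟩
    · intro a _ b _ h
      exact Subtype.ext h
    · intro u hu
      simp only [Finset.mem_filter, Finset.mem_univ, true_and] at hu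
      exact ⟨⟨u, hu.1⟩, by simpa using hu.2, rfl⟩
    · intro u _
      simp [S, u.2]
  have hvar (w i j) : G (var w i j) = X s((w.1, j), (p w, i)) := C.gatePoly_of_var rfl
  have hedge (w i j) : G (edge w i j) = X s((w.1, j), (p w, i)) *
      ∏ u ∈ Finset.univ.filter (fun u => u ≠ 0 ∧ p u = w), S u j := by
    by_cases h : ∃ u, u ≠ 0 ∧ p u = w
    · have hl : C.gate (edge w i j) =
          .mul (insert (var ⟨w, w.2, h⟩ i j) (childSums w.1 j)) := dif_pos h
      have h1 : G (edge w i j) =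
        ∏ g ∈ insert (var ⟨w, w.2, h⟩ i j) (childSums w.1 j), G g := C.gatePoly_of_mul hl
      rw [h1, Finset.prod_insert, hvar, hchild]
      intro hmem
      obtain ⟨u, -, hu⟩ := mem_childSums.1 hmem
      cases hu
    · have hl : C.gate (edge w i j) = .var s((w.1, j), (p w, i)) := dif_neg h
      have h1 : G (edge w i j) = X s((w.1, j), (p w, i)) := C.gatePoly_of_var hl
      rw [h1, Finset.filter_false_of_mem fun u _ hu => h ⟨u, hu⟩, Finset.prod_empty, mul_one]
  have hS (w : Fin k) (hw : w ≠ 0) (i : Fin n) : S w i = ∑ j, X s((w, j), (p w, i)) *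
      ∏ u ∈ Finset.univ.filter (fun u => u ≠ 0 ∧ p u = w), S u j := by
    have h1 : G (sum ⟨w, hw⟩ i) = ∑ g ∈ Finset.univ.image (edge ⟨w, hw⟩ i), G g :=
      C.gatePoly_of_add rfl
    rw [show S w i = G (sum ⟨w, hw⟩ i) from dif_pos hw, h1,
      Finset.sum_image (by intro a _ b _ h; injection h)]
    exact Finset.sum_congr rfl fun j _ => hedge _ _ _
  have hroot (i : Fin n) : G (root i) =
      ∏ u ∈ Finset.univ.filter (fun u => u ≠ 0 ∧ p u = 0), S u i := by
    rw [← hchild]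
    exact C.gatePoly_of_mul rfl
  have hout : C.poly = ∑ g ∈ Finset.univ.image (root : Fin n → TreeGate p n), G g :=
    C.gatePoly_of_add rfl
  rw [hout, Finset.sum_image (by intro a _ b _ h; injection h),
    Finset.sum_congr rfl fun i _ => hroot i, hp.colSub_eq]
  exact hp.sum_prod_children_eq hn (fun w i j => X s((w, j), (p w, i))) S hS

end TreeCircuit

/-! ### Levels, and the explicit tree in heap order. -/

theorem IsParentMap.exists_level {k L : ℕ} [NeZero k] {p : Fin k → Fin k}
    (hL : ∀ w, p^[L] w = 0) :
    ∃ lev : Fin k → ℕ, lev 0 = 0 ∧ (∀ w, w ≠ 0 → lev w = lev (p w) + 1) ∧ ∀ w, lev w ≤ L := by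
  have hex (w : Fin k) : ∃ t, p^[t] w = 0 := ⟨L, hL w⟩
  refine ⟨fun w => Nat.find (hex w), ?_, fun w hw => ?_, fun w => Nat.find_le (hL w)⟩
  · exact (Nat.find_eq_zero _).2 rfl
  · exact Nat.find_comp_succ (hex w) (hex (p w)) hw

/-- The number of vertices in the first `l` generations of the full `d`-ary tree. -/
def heapSize (d : ℕ) : ℕ → ℕ
  | 0 => 0
  | l + 1 => d * heapSize d l + 1

theorem heapSize_succ (d l : ℕ) : heapSize d (l + 1) = heapSize d l + d ^ l := by
  induction l with
  | zero => simp [heapSize]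
  | succ l ih =>
    have h : heapSize d (l + 1) = d * heapSize d l + 1 := rfl
    rw [heapSize, ih, Nat.mul_add, ← ih, h, pow_succ]
    ring

theorem heapSize_mono (d : ℕ) : Monotone (heapSize d) :=
  monotone_nat_of_le_succ fun l => by rw [heapSize_succ]; exact Nat.le_add_right _ _

theorem heapSize_succ_lt {d : ℕ} (hd : 2 ≤ d) (l : ℕ) : heapSize d (l + 1) < 2 * d ^ l := by
  induction l with
  | zero => simp [heapSize]
  | succ l ih =>
    rw [heapSize, pow_succ]
    have := Nat.mul_le_mul_left d (Nat.succ_le_of_lt ih)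
    rw [Nat.mul_succ] at this
    linarith

/-- The parent map of the full `d`-ary tree of depth `Δ`, in breadth-first order, with a pendant
vertex at each of its leaves and all further vertices attached to the root. -/
def heapParent (d Δ i : ℕ) : ℕ :=
  if i < heapSize d (Δ + 1) then (i - 1) / d
  else if i < heapSize d (Δ + 1) + d ^ Δ then i - d ^ Δ else 0

theorem heapParent_zero (d Δ : ℕ) : heapParent d Δ 0 = 0 := by
  simp [heapParent]

theorem heapParent_lt {d : ℕ} (hd : 0 < d) (Δ : ℕ) {i : ℕ} (hi : i ≠ 0) :
    heapParent d Δ i < i := by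
  have h1 : 0 < d ^ Δ := pow_pos hd Δ
  have h2 : (i - 1) / d ≤ i - 1 := Nat.div_le_self _ _
  unfold heapParent
  split_ifs <;> omega

theorem heapParent_iterate {d : ℕ} (hd : 0 < d) {Δ : ℕ} (l : ℕ) (hl : l ≤ Δ) {i : ℕ}
    (hi : i < heapSize d (l + 1)) : (heapParent d Δ)^[l] i = 0 := by
  induction l generalizing i with
  | zero => simpa [heapSize] using hi
  | succ l ih =>
    rw [Function.iterate_succ_apply]
    refine ih (by omega) ?_
    rw [heapParent, if_pos (hi.trans_le (heapSize_mono d (by omega)))]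
    rw [Nat.div_lt_iff_lt_mul hd]
    rw [heapSize, mul_comm] at hi
    have : 0 < heapSize d (l + 1) * d := Nat.mul_pos (Nat.succ_pos _) hd
    omega

theorem heapParent_iterate_eq_zero {d : ℕ} (hd : 0 < d) (Δ i : ℕ) :
    (heapParent d Δ)^[Δ + 1] i = 0 := by
  by_cases h1 : i < heapSize d (Δ + 1)
  · rw [Function.iterate_succ_apply', heapParent_iterate hd Δ le_rfl h1, heapParent_zero]
  · rw [Function.iterate_succ_apply, heapParent, if_neg h1]
    refine heapParent_iterate hd Δ le_rfl ?_
    have : 0 < heapSize d (Δ + 1) := Nat.succ_pos _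
    split_ifs <;> omega

/-- A `d`-ary tree of depth `Δ`, with a pendant vertex at each leaf, on `k` vertices. -/
theorem exists_isBranching {k d Δ : ℕ} [NeZero k] (hd : 2 ≤ d) (hk : 3 * d ^ Δ ≤ k) :
    ∃ p : Fin k → Fin k, IsParentMap p ∧ (∀ w, p^[Δ + 1] w = 0) ∧ IsBranching p d Δ 0 := by
  classical
  have hd0 : 0 < d := by omega
  have hle (i : ℕ) : heapParent d Δ i ≤ i := by
    by_cases hi : i = 0
    · rw [hi, heapParent_zero]
    · exact (heapParent_lt hd0 Δ hi).le
  let p : Fin k → Fin k := fun w => ⟨heapParent d Δ w, (hle w).trans_lt w.isLt⟩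
  have hiter (t : ℕ) (w : Fin k) : (p^[t] w).val = (heapParent d Δ)^[t] w.val := by
    induction t generalizing w with
    | zero => rfl
    | succ t ih => rw [Function.iterate_succ_apply, Function.iterate_succ_apply, ih]
  have hsize := heapSize_succ_lt hd Δ
  have hpos : 0 < d ^ Δ := pow_pos hd0 Δ
  have hbranch : ∀ j l, j + l = Δ → ∀ w : Fin k, heapSize d l ≤ w.val →
      w.val < heapSize d (l + 1) → IsBranching p d j w := by
    intro j
    induction j with
    | zero =>
      intro l hl w h1 h2
      obtain rfl : l = Δ := by omega
      have h3 := heapSize_succ d l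
      -- The last generation has `d ^ l` vertices, so shifting by this number leads to the pendant
      -- vertices. They fit because `heapSize d (l + 1) + d ^ l < 3 * d ^ l ≤ k`.
      refine ⟨⟨w.val + d ^ l, by omega⟩, fun h => ?_, Fin.ext ?_⟩
      · have := congrArg Fin.val h
        simp only [Fin.val_zero] at this
        omega
      · change heapParent d l (w.val + d ^ l) = w.val
        rw [heapParent, if_neg (by omega), if_pos (by omega), Nat.add_sub_cancel]
    | succ j ih =>
      intro l hl w h1 h2
      have h3 : heapSize d (l + 2) ≤ heapSize d (Δ + 1) := heapSize_mono d (by omega)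
      have h4 : d * w.val + d ≤ d * heapSize d (l + 1) := by
        rw [← Nat.mul_succ]
        exact Nat.mul_le_mul_left d h2
      have h5 : heapSize d (l + 2) = d * heapSize d (l + 1) + 1 := rfl
      have h6 : heapSize d (l + 1) = d * heapSize d l + 1 := rfl
      have h7 : d * heapSize d l ≤ d * w.val := Nat.mul_le_mul_left d h1
      have hlt (i : Fin d) : d * w.val + 1 + i.val < heapSize d (l + 2) := by
        have := i.isLt
        omega
      -- The children of `w` in heap order.
      let φ : Fin d → Fin k := fun i => ⟨d * w.val + 1 + i.val, by have := hlt i; omega⟩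
      have hφ : Function.Injective φ := fun a b hab => by
        have := congrArg Fin.val hab
        simp only [φ] at this
        exact Fin.ext (by omega)
      refine ⟨Finset.univ.image φ, ?_, fun u hu => ?_⟩
      · rw [Finset.card_image_of_injective _ hφ, Finset.card_univ, Fintype.card_fin]
      obtain ⟨i, -, rfl⟩ := Finset.mem_image.1 hu
      refine ⟨fun h => ?_, Fin.ext ?_, ih (l + 1) (by omega) _ ?_ (hlt i)⟩
      · have := congrArg Fin.val h
        simp only [φ, Fin.val_zero] at this
        omega
      · change heapParent d Δ (d * w.val + 1 + i.val) = w.val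
        rw [heapParent, if_pos ((hlt i).trans_le h3),
          show d * w.val + 1 + i.val - 1 = i.val + d * w.val by omega,
          Nat.add_mul_div_left _ _ hd0, Nat.div_eq_of_lt i.isLt, zero_add]
      · change heapSize d (l + 1) ≤ d * w.val + 1 + i.val
        omega
  refine ⟨p, ⟨Fin.ext (heapParent_zero d Δ), fun w hw => ?_⟩, fun w => Fin.ext ?_, ?_⟩
  · exact heapParent_lt hd0 Δ fun h => hw (Fin.ext h)
  · rw [hiter, heapParent_iterate_eq_zero hd0]
    rfl
  · exact hbranch Δ 0 rfl 0 (Nat.zero_le _) (by simp [heapSize])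

/-! ### Choice of `d` and the exponent of the lower bound. -/

theorem rpow_one_div_le {k d Δ : ℕ} (hΔ : 1 ≤ Δ) (hk : k ≤ 3 * (d + 1) ^ Δ) :
    (k : ℝ) ^ (1 / (Δ : ℝ)) ≤ 3 * (d + 1) := by
  have h1 : (k : ℝ) ≤ (3 * ((d : ℝ) + 1)) ^ Δ := by
    have h2 : (k : ℝ) ≤ 3 * ((d : ℝ) + 1) ^ Δ := by exact_mod_cast hk
    have h3 : (3 : ℝ) ≤ 3 ^ Δ := le_self_pow₀ (by norm_num) (by omega)
    rw [mul_pow]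
    exact h2.trans (mul_le_mul_of_nonneg_right h3 (by positivity))
  calc (k : ℝ) ^ (1 / (Δ : ℝ)) ≤ ((3 * ((d : ℝ) + 1)) ^ Δ) ^ (1 / (Δ : ℝ)) :=
        Real.rpow_le_rpow (Nat.cast_nonneg k) h1 (by positivity)
    _ = 3 * (d + 1) := by
        rw [one_div]
        exact Real.pow_rpow_inv_natCast (by positivity) (by omega)

/-- The constant `1/6` arises from `k^(1/Δ) ≤ 3 * (d + 1) ≤ 6 * e`. The exponent `e` is `d` if `d ≥
2`, and `1` otherwise. -/
theorem rpow_le_of_pow_le {k n d e N Δ : ℕ} (hΔ : 1 ≤ Δ) (hn : 1 ≤ n)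
    (hk : k ≤ 3 * (d + 1) ^ Δ) (hde : d + 1 ≤ 2 * e) (h : n ^ e ≤ N) :
    (n : ℝ) ^ (1 / 6 * (k : ℝ) ^ (1 / (Δ : ℝ))) ≤ (N : ℝ) := by
  have h1 := rpow_one_div_le hΔ hk
  have h2 : (d : ℝ) + 1 ≤ 2 * e := by exact_mod_cast hde
  calc (n : ℝ) ^ (1 / 6 * (k : ℝ) ^ (1 / (Δ : ℝ))) ≤ (n : ℝ) ^ (e : ℝ) :=
        Real.rpow_le_rpow_of_exponent_le (by exact_mod_cast hn) (by linarith)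
    _ = ((n ^ e : ℕ) : ℝ) := by rw [Real.rpow_natCast, Nat.cast_pow]
    _ ≤ N := by exact_mod_cast h

/-- Parent maps of trees on `k` vertices whose colored subgraph polynomials are hard for monotone
circuits of product-depth `Δ`. -/
theorem exists_hard_parentMap {k Δ : ℕ} [NeZero k] (hΔ : 1 ≤ Δ) (hk : 2 ≤ k) :
    ∃ p : Fin k → Fin k, IsParentMap p ∧ (∀ w, p^[Δ + 1] w = 0) ∧ ∀ n : ℕ, 1 ≤ n →
      ∀ C : AlgCircuit (Sym2 (Fin k × Fin n)), C.IsMonotone → C.productDepth ≤ Δ →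
        C.poly = colSub (parentGraph p) n →
          (n : ℝ) ^ (1 / 6 * (k : ℝ) ^ (1 / (Δ : ℝ))) ≤ (C.size : ℝ) := by
  -- `d` is the largest admissible arity, possibly `0`. Searching up to `k` loses nothing, since `d
  -- ≤ d ^ Δ`.
  obtain ⟨d, hdk, hkd⟩ : ∃ d, 3 * d ^ Δ ≤ k ∧ k ≤ 3 * (d + 1) ^ Δ := by
    have h0 : 3 * 0 ^ Δ ≤ k := by simp [Nat.one_le_iff_ne_zero.1 hΔ]
    have hlt : Nat.findGreatest (fun d => 3 * d ^ Δ ≤ k) k < k + 1 :=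
      Nat.lt_succ_of_le (Nat.findGreatest_le k)
    refine ⟨Nat.findGreatest (fun d => 3 * d ^ Δ ≤ k) k,
      Nat.findGreatest_spec (P := fun d => 3 * d ^ Δ ≤ k) (Nat.zero_le k) h0, ?_⟩
    by_contra! h
    have h1 : Nat.findGreatest (fun d => 3 * d ^ Δ ≤ k) k + 1 ≤ k := by
      have := Nat.le_self_pow (n := Δ) (by omega)
        (Nat.findGreatest (fun d => 3 * d ^ Δ ≤ k) k + 1)
      omega
    have := Nat.le_findGreatest (P := fun d => 3 * d ^ Δ ≤ k) h1 h.le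
    omega
  by_cases hd : 2 ≤ d
  · obtain ⟨p, hp, hL, hbranch⟩ := exists_isBranching (Δ := Δ) hd hdk
    exact ⟨p, hp, hL, fun n hn C hC hdepth hpoly => rpow_le_of_pow_le hΔ hn hkd (by omega)
      (AlgCircuit.pow_le_size_of_isBranching hp hd hΔ hbranch hC hdepth hpoly hn)⟩
  -- For `d ≤ 1` a star suffices, as the required bound is at most `n`.
  · have hp : IsParentMap fun _ : Fin k => (0 : Fin k) :=
      ⟨rfl, fun w hw => Nat.pos_of_ne_zero fun h => hw (Fin.ext h)⟩
    refine ⟨fun _ => 0, hp, fun w => Function.iterate_succ_apply' _ _ _, ?_⟩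
    intro n hn C _ _ hpoly
    have hne : (⟨1, hk⟩ : Fin k) ≠ 0 := fun h => one_ne_zero (congrArg Fin.val h)
    refine rpow_le_of_pow_le (e := 1) hΔ hn hkd (by omega) ?_
    rw [pow_one]
    exact AlgCircuit.le_size_of_colSub (hp.mem_edgeSet hne) hpoly

theorem exists_hard_tree {Δ k : ℕ} (hΔ : 1 ≤ Δ) (hk : 2 ≤ k) :
    ∃ H : SimpleGraph (Fin k), H.IsTree ∧ ∀ n : ℕ, 1 ≤ n →
      (∃ C : AlgCircuit (Sym2 (Fin k × Fin n)),
        C.IsMonotone ∧ C.IsLayered ∧ C.productDepth ≤ Δ + 1 ∧ C.poly = colSub H n ∧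
          (C.size : ℝ) ≤ 5 * ((n : ℝ) ^ 2 * k)) ∧
      (∀ C : AlgCircuit (Sym2 (Fin k × Fin n)),
        C.IsMonotone → C.productDepth ≤ Δ → C.poly = colSub H n →
          (n : ℝ) ^ (1 / 6 * (k : ℝ) ^ (1 / (Δ : ℝ))) ≤ (C.size : ℝ)) := by
  have : NeZero k := ⟨by omega⟩
  obtain ⟨p, hp, hL, hlower⟩ := exists_hard_parentMap (k := k) hΔ hk
  refine ⟨parentGraph p, hp.isTree, fun n hn => ⟨?_, hlower n hn⟩⟩
  obtain ⟨lev, h0, hlev, hle⟩ := IsParentMap.exists_level hL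
  have hroot : ∃ u, u ≠ 0 ∧ p u = 0 := by
    have hne : (⟨1, hk⟩ : Fin k) ≠ 0 := fun h => one_ne_zero (congrArg Fin.val h)
    have h := hp.map_lt _ hne
    rw [Fin.lt_def] at h
    exact ⟨_, hne, Fin.ext (Nat.lt_one_iff.1 h)⟩
  exact ⟨treeCircuit h0 hlev hle hn hroot, treeCircuit_isMonotone h0 hlev hle hn hroot,
    treeCircuit_isLayered ..,
    treeCircuit_productDepth_le .., treeCircuit_poly h0 hlev hle hn hroot hp,
    by exact_mod_cast treeCircuit_size_le h0 hlev hle hn hroot⟩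

/-- The circuit whose only gate is the constant `1`. -/
def oneCircuit (σ : Type) : AlgCircuit σ where
  V := Unit
  gate _ := .const 1
  output := ()
  acyclic := ⟨fun _ => ⟨_, fun _ h => absurd h (Finset.notMem_empty _)⟩⟩
  nonempty_of_inner _ h := absurd h (by simp [GateLabel.IsAdd, GateLabel.IsMul])

theorem oneCircuit_isLayered (σ : Type) : (oneCircuit σ).IsLayered where
  layers := ⟨fun _ => 0, rfl, fun _ _ h => absurd h (Finset.notMem_empty _)⟩
  unique_root _ h := absurd rfl h
  add_alternate _ h := absurd h id
  mul_alternate _ h := absurd h id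


theorem theorem3 :
    ∃ K c : ℝ, 0 < K ∧ 0 < c ∧
      (∀ Δ k : ℕ, 1 ≤ Δ → 2 ≤ k →
        ∃ H : SimpleGraph (Fin k), H.IsTree ∧
          ∀ n : ℕ, 1 ≤ n →
            (∃ C : AlgCircuit (Sym2 (Fin k × Fin n)),
              C.IsMonotone ∧ C.IsLayered ∧ C.productDepth ≤ Δ + 1 ∧ C.poly = colSub H n ∧
                (C.size : ℝ) ≤ K * ((n : ℝ) ^ 2 * k)) ∧
            (∀ C : AlgCircuit (Sym2 (Fin k × Fin n)),
              C.IsMonotone → C.productDepth ≤ Δ → C.poly = colSub H n →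
                (n : ℝ) ^ (c * (k : ℝ) ^ (1 / (Δ : ℝ))) ≤ (C.size : ℝ))) ∧
      (∀ Δ n : ℕ, 1 ≤ Δ → 1 ≤ n →
        ∃ H : SimpleGraph (Fin n), H.IsTree ∧
          (∃ C : AlgCircuit (Sym2 (Fin n × Fin n)),
            C.IsMonotone ∧ C.IsLayered ∧ C.productDepth ≤ Δ + 1 ∧ C.poly = colSub H n ∧
              (C.size : ℝ) ≤ K * (n : ℝ) ^ 3) ∧
          (∀ C : AlgCircuit (Sym2 (Fin n × Fin n)),
            C.IsMonotone → C.productDepth ≤ Δ → C.poly = colSub H n →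
              (n : ℝ) ^ (c * (n : ℝ) ^ (1 / (Δ : ℝ))) ≤ (C.size : ℝ))) := by
  refine ⟨5, 1 / 6, by norm_num, by norm_num, fun Δ k hΔ hk => exists_hard_tree hΔ hk,
    fun Δ n hΔ hn => ?_⟩
  -- For `n = 1` the tree is a single vertex and its polynomial is `1`. It is treated apart because
  -- the root of `treeCircuit` needs a child.
  obtain rfl | hn2 := hn.eq_or_lt
  · have hp : IsParentMap (id : Fin 1 → Fin 1) :=
      ⟨rfl, fun w hw => absurd (Subsingleton.elim w 0) hw⟩
    refine ⟨parentGraph id, hp.isTree, ⟨oneCircuit _, ?_, oneCircuit_isLayered _, ?_, ?_, ?_⟩, ?_⟩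
    · intro g a h
      rw [← GateLabel.const.inj h]
      exact zero_le_one
    · rw [AlgCircuit.productDepth, AlgCircuit.gateDepth_eq]
      exact Nat.zero_le _
    · rw [hp.colSub_eq, AlgCircuit.poly, (oneCircuit _).gatePoly_of_const rfl]
      simp
    · have : (oneCircuit (Sym2 (Fin 1 × Fin 1))).size = 1 := Fintype.card_unit
      rw [this]
      norm_num
    · intro C _ _ _
      rw [Nat.cast_one, Real.one_rpow, Nat.one_le_cast]
      exact Fintype.card_pos_iff.2 ⟨C.output⟩
  · obtain ⟨H, hH, h⟩ := exists_hard_tree (k := n) hΔ hn2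
    obtain ⟨⟨C, h1, h2, h3, h4, h5⟩, hlower⟩ := h n hn
    refine ⟨H, hH, ⟨C, h1, h2, h3, h4, h5.trans (le_of_eq ?_)⟩, hlower⟩
    ring
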